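/- Let $Var$ be a denumerable set of variables and let formulas be built from $Var$ with the connectives $\land,\lor,\to,0,1$ and the binary connective $\boxright$ (the counterfactual). Put $\neg x:=x\to 0$, $x\leftrightarrow y:=(x\to y)\land(y\to x)$, $x\Diamondright y:=\neg(x\boxright\neg y)$, $\Box x:=\neg x\boxright x$, $\Diamond x:=\neg\Box\neg x$, $x\preccurlyeq y:=((x\lor y)\Diamondright(x\lor y))\to((x\lor y)\Diamondright x)$, $x\prec y:=\neg(y\preccurlyeq x)$. Consider the following axiom schemas: - (W) $(\varphi\boxright\psi)\to(\varphi\to\psi)$; - (C) $((\varphi\boxright\psi)\to(\varphi\to\psi))\land((\varphi\land\psi)\to(\varphi\boxright\psi))$; - (N) $\Box\varphi\to\Diamond\varphi$; - (T) $\Box\varphi\to\varphi$; - (S) $(\varphi\boxright\psi)\lor(\varphi\boxright\neg\psi)$; - (U) $(\Diamond\varphi\to\Box\Diamond\varphi)\land(\Box\varphi\to\Box\Box\varphi)$; - (A) $((\varphi\preccurlyeq\psi)\to\Box(\varphi\preccurlyeq\psi))\land((\varphi\prec\psi)\to\Box(\varphi\prec\psi))$. For $\Sigma\subseteq\{W,C,N,T,S,U,A\}$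 let $\vdash_{\mathbf{GV}\Sigma}$ be derivability in the Hilbert calculus (equivalently, the smallest finitary consequence relation) with: Hilbert-style axiom schemas of classical logic; the schemas - (L1) $\varphi\boxright\varphi$, - (L2) $((\varphi\boxright\psi)\land(\psi\boxright\varphi))\to((\varphi\boxright\gamma)\leftrightarrow(\psi\boxright\gamma))$, - (L3) $((\varphi\lor\psi)\boxright\varphi)\lor((\varphi\lor\psi)\boxright\psi)\lor(((\varphi\lor\psi)\boxright\gamma)\leftrightarrow((\varphi\boxright\gamma)\land(\psi\boxright\gamma)))$, - (L4) $(\varphi\boxright(\psi\land\gamma))\leftrightarrow((\varphi\boxright\psi)\land(\varphi\boxright\gamma))$; the schemas in $\Sigma$; and the rules $\varphi,\varphi\to\psi\vdash\psi$ and $\varphi\to\psi\vdash(\gamma\boxright\varphi)\to(\gamma\boxright\psi)$, both applicable to arbitrary formulas derived from the premises. A sphere model is $\mathcal M=\langle W,\mathcal S,v\rangle$, where $W$ is a set, $\mathcal S$ assigns to each $w\in W$ a set $\mathcal S(w)$ of nonempty subsets of $W$ that is linearly ordered by inclusion, and $v$ assigns to each variable a subset of $W$; $v$ extends to all formulas by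 the usual Boolean clauses and $$v(\varphi\boxright\psi)=\{w: \textstyle\bigcup\mathcal S(w)\cap v(\varphi)=\emptyset\text{ or }\emptyset\ne X\cap v(\varphi)\subseteq v(\psi)\text{ for some }X\in\mathcal S(w)\}.$$ Write $\mathcal M\Vdash\Gamma$ if $v(\gamma)=W$ for all $\gamma\in\Gamma$. Let $\mathsf K_\Sigma$ be the class of all sphere models that satisfy, for each axiom in $\Sigma$, the corresponding condition, for all $w,w'\in W$: - W (weakly centered): some nonempty set belongs to $\mathcal S(w)$, and $w$ belongs to every nonempty $X\in\mathcal S(w)$; - C (centered): $\{w\}\in\mathcal S(w)$; - N (normal): $\bigcup\mathcal S(w)\neq\emptyset$; - T (totally reflexive): $w\in\bigcup\mathcal S(w)$; - S (Stalnakerian): for every formula $\varphi$ with $v(\varphi)\cap\bigcup\mathcal S(w)\ne\emptyset$ there are $X\in\mathcal S(w)$ and $y\in W$ with $v(\varphi)\cap X=\{y\}$; - U (uniform): $\bigcup\mathcal S(w)=\bigcup\mathcal S(w')$; - A (absolute): $\mathcal S(w)=\mathcal S(w')$. Write $\Gamma\models_{\mathsf K_\Sigma,g}\varphi$ if, for all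 $\mathcal M\in\mathsf K_\Sigma$, $\mathcal M\Vdash\Gamma$ implies $\mathcal M\Vdash\varphi$. **Theorem (soundness and finite strong completeness).** For every $\Sigma\subseteq\{W,C,N,T,S,U,A\}$, every finite set of formulas $\Gamma$ and every formula $\varphi$, $$\Gamma\vdash_{\mathbf{GV}\Sigma}\varphi\quad\text{if and only if}\quad\Gamma\models_{\mathsf K_\Sigma,g}\varphi.$$ -/

import Mathlib

universe u

namespace Lewis

/-- Formulas over the variables `p₀, p₁, …`, in the primitive connectives `∧, ∨, →, 0, 1, □→`. -/
inductive Form : Type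
  | var : ℕ → Form
  | bot : Form
  | top : Form
  | and : Form → Form → Form
  | or : Form → Form → Form
  | imp : Form → Form → Form
  | cf : Form → Form → Form

infixr:70 " ⋏ " => Form.and
infixr:65 " ⋎ " => Form.or
infixr:55 " ⇾ " => Form.imp
infix:75 " □→ " => Form.cf

namespace Form

/-! Derived connectives. -/

/-- Negation `φ → 0`. -/
def neg (φ : Form) : Form := φ ⇾ bot

/-- Classical biconditional. -/
def iff (φ ψ : Form) : Form := (φ ⇾ ψ) ⋏ (ψ ⇾ φ)

/-- The might-counterfactual `¬ (φ □→ ¬ ψ)`. -/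
def might (φ ψ : Form) : Form := neg (φ □→ neg ψ)

/-- Necessity `¬ φ □→ φ`. -/
def box (φ : Form) : Form := neg φ □→ φ

/-- Possibility `¬ □ ¬ φ`. -/
def dia (φ : Form) : Form := neg (box (neg φ))

/-- Comparative possibility `φ ≼ ψ`. -/
def preceq (φ ψ : Form) : Form := might (φ ⋎ ψ) (φ ⋎ ψ) ⇾ might (φ ⋎ ψ) φ

/-- Strict comparative possibility `φ ≺ ψ`. -/
def prec (φ ψ : Form) : Form := neg (preceq ψ φ)

end Form

open Form

/-- The names of the optional axioms. -/
inductive AxName : Type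
  | W | C | N | T | S | U | A

/-- Hilbert-style axiom schemas of classical propositional logic (with modus ponens). -/
inductive ClassicalAxiom : Form → Prop
  | k (φ ψ) : ClassicalAxiom (φ ⇾ ψ ⇾ φ)
  | s (φ ψ χ) : ClassicalAxiom ((φ ⇾ ψ ⇾ χ) ⇾ (φ ⇾ ψ) ⇾ φ ⇾ χ)
  | and_left (φ ψ) : ClassicalAxiom (φ ⋏ ψ ⇾ φ)
  | and_right (φ ψ) : ClassicalAxiom (φ ⋏ ψ ⇾ ψ)
  | and_intro (φ ψ) : ClassicalAxiom (φ ⇾ ψ ⇾ φ ⋏ ψ)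
  | or_left (φ ψ) : ClassicalAxiom (φ ⇾ φ ⋎ ψ)
  | or_right (φ ψ) : ClassicalAxiom (ψ ⇾ φ ⋎ ψ)
  | or_elim (φ ψ χ) : ClassicalAxiom ((φ ⇾ χ) ⇾ (ψ ⇾ χ) ⇾ φ ⋎ ψ ⇾ χ)
  | verum : ClassicalAxiom top
  | efq (φ) : ClassicalAxiom (bot ⇾ φ)
  | dne (φ) : ClassicalAxiom (neg (neg φ) ⇾ φ)

/-- The axiom schemas common to all the logics: classical logic and L1, L2, L3, L4. -/
inductive BaseAxiom : Form → Prop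
  | classical {φ} : ClassicalAxiom φ → BaseAxiom φ
  | l1 (φ) : BaseAxiom (φ □→ φ)
  | l2 (φ ψ γ) : BaseAxiom ((φ □→ ψ) ⋏ (ψ □→ φ) ⇾ iff (φ □→ γ) (ψ □→ γ))
  | l3 (φ ψ γ) : BaseAxiom
      (((φ ⋎ ψ) □→ φ) ⋎ ((φ ⋎ ψ) □→ ψ) ⋎
        iff ((φ ⋎ ψ) □→ γ) ((φ □→ γ) ⋏ (ψ □→ γ)))
  | l4 (φ ψ γ) : BaseAxiom (iff (φ □→ (ψ ⋏ γ)) ((φ □→ ψ) ⋏ (φ □→ γ)))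

/-- The instances of each optional axiom schema. -/
inductive ExtraAxiom : AxName → Form → Prop
  | W (φ ψ) : ExtraAxiom .W ((φ □→ ψ) ⇾ (φ ⇾ ψ))
  | C (φ ψ) : ExtraAxiom .C (((φ □→ ψ) ⇾ (φ ⇾ ψ)) ⋏ (φ ⋏ ψ ⇾ (φ □→ ψ)))
  | N (φ) : ExtraAxiom .N (box φ ⇾ dia φ)
  | T (φ) : ExtraAxiom .T (box φ ⇾ φ)
  | S (φ ψ) : ExtraAxiom .S ((φ □→ ψ) ⋎ (φ □→ neg ψ))
  | U (φ) : ExtraAxiom .U ((dia φ ⇾ box (dia φ)) ⋏ (box φ ⇾ box (box φ)))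
  | A (φ ψ) : ExtraAxiom .A
      ((preceq φ ψ ⇾ box (preceq φ ψ)) ⋏ (prec φ ψ ⇾ box (prec φ ψ)))

/-- `GVProves Σ Γ φ`: the formula `φ` is derivable from the premises `Γ` in the strong calculus
`GVΣ`, in which the rule C applies to all derivations (not only to theorems). -/
inductive GVProves (Sig : Set AxName) (Γ : Set Form) : Form → Prop
  | hyp {φ} : φ ∈ Γ → GVProves Sig Γ φ
  | base {φ} : BaseAxiom φ → GVProves Sig Γ φ
  | extra {a φ} : a ∈ Sig → ExtraAxiom a φ → GVProves Sig Γ φ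
  | mp {φ ψ} : GVProves Sig Γ φ → GVProves Sig Γ (φ ⇾ ψ) → GVProves Sig Γ ψ
  | ruleC {φ ψ} (γ) : GVProves Sig Γ (φ ⇾ ψ) → GVProves Sig Γ ((γ □→ φ) ⇾ (γ □→ ψ))

/-- Consequence relations on formulas. -/
structure IsConsequence (R : Set Form → Form → Prop) : Prop where
  refl : ∀ Γ α, α ∈ Γ → R Γ α
  cut : ∀ Γ Δ β, (∀ δ ∈ Δ, R Γ δ) → R Δ β → R Γ β

/-- Finitary relations. -/
def IsFinitary (R : Set Form → Form → Prop) : Prop :=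
  ∀ Γ α, R Γ α → ∃ Γ₀ ⊆ Γ, Γ₀.Finite ∧ R Γ₀ α

/-- `R` is a finitary consequence relation having the axioms of `GVΣ` as theorems and satisfying
modus ponens and the rule C. -/
structure IsGVLogic (Sig : Set AxName) (R : Set Form → Form → Prop) : Prop where
  conseq : IsConsequence R
  finitary : IsFinitary R
  base : ∀ φ, BaseAxiom φ → R ∅ φ
  extra : ∀ a ∈ Sig, ∀ φ, ExtraAxiom a φ → R ∅ φ
  mp : ∀ φ ψ, R {φ, φ ⇾ ψ} ψ
  ruleC : ∀ φ ψ γ, R {φ ⇾ ψ} ((γ □→ φ) ⇾ (γ □→ ψ))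

theorem GVProves.mono {Sig : Set AxName} {Γ Δ : Set Form} (h : Γ ⊆ Δ) {φ : Form}
    (d : GVProves Sig Γ φ) : GVProves Sig Δ φ := by
  induction d with
  | hyp m => exact .hyp (h m)
  | base b => exact .base b
  | extra a b => exact .extra a b
  | mp _ _ ih₁ ih₂ => exact .mp ih₁ ih₂
  | ruleC γ _ ih => exact .ruleC γ ih

/-- Derivability in the Hilbert calculus is the smallest finitary consequence relation with the
axioms of `GVΣ`, modus ponens and the rule C. -/
theorem gvProves_isLeast (Sig : Set AxName) :
    IsLeast {R : Set Form → Form → Prop | IsGVLogic Sig R} (GVProves Sig) := by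
  refine ⟨⟨⟨fun _ _ m => .hyp m, ?_⟩, ?_, fun _ b => .base b, fun _ a _ b => .extra a b, ?_, ?_⟩, ?_⟩
  · intro Γ Δ β hΔ d
    induction d with
    | hyp m => exact hΔ _ m
    | base b => exact .base b
    | extra a b => exact .extra a b
    | mp _ _ ih₁ ih₂ => exact .mp ih₁ ih₂
    | ruleC γ _ ih => exact .ruleC γ ih
  · intro Γ α d
    induction d with
    | @hyp φ m => exact ⟨{φ}, by simpa using m, Set.finite_singleton _, .hyp rfl⟩
    | base b => exact ⟨∅, by simp, Set.finite_empty, .base b⟩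
    | extra a b => exact ⟨∅, by simp, Set.finite_empty, .extra a b⟩
    | mp _ _ ih₁ ih₂ =>
      obtain ⟨Γ₁, h₁, f₁, d₁⟩ := ih₁
      obtain ⟨Γ₂, h₂, f₂, d₂⟩ := ih₂
      exact ⟨Γ₁ ∪ Γ₂, Set.union_subset h₁ h₂, f₁.union f₂,
        .mp (d₁.mono Set.subset_union_left) (d₂.mono Set.subset_union_right)⟩
    | ruleC γ _ ih =>
      obtain ⟨Γ₁, h₁, f₁, d₁⟩ := ih
      exact ⟨Γ₁, h₁, f₁, .ruleC γ d₁⟩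
  · intro φ ψ
    exact .mp (.hyp (Set.mem_insert _ _)) (.hyp (by simp))
  · intro φ ψ γ
    exact .ruleC γ (.hyp rfl)
  · intro R hR Γ φ d
    induction d with
    | hyp m => exact hR.conseq.refl _ _ m
    | base b => exact hR.conseq.cut _ ∅ _ (by simp) (hR.base _ b)
    | extra a b => exact hR.conseq.cut _ ∅ _ (by simp) (hR.extra _ a _ b)
    | @mp φ ψ _ _ ih₁ ih₂ =>
      refine hR.conseq.cut _ _ _ ?_ (hR.mp φ ψ)
      rintro δ (rfl | rfl)
      · exact ih₁
      · exact ih₂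
    | ruleC γ _ ih =>
      refine hR.conseq.cut _ _ _ ?_ (hR.ruleC _ _ γ)
      rintro δ rfl
      exact ih

/-- Sphere models. -/
structure SphereModel : Type (u + 1) where
  /-- the set of worlds -/
  World : Type u
  /-- the spheres around each world -/
  sph : World → Set (Set World)
  /-- the spheres around a world are nonempty and nested -/
  nested : ∀ w, ∀ X ∈ sph w, ∀ Y ∈ sph w, (X.Nonempty ∧ X ⊆ Y) ∨ (Y.Nonempty ∧ Y ⊆ X)
  /-- the assignment of the variables -/
  val : ℕ → Set World

namespace SphereModel

/-- The extension of the assignment to all formulas. -/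
def ext (M : SphereModel.{u}) : Form → Set M.World
  | .var n => M.val n
  | .bot => ∅
  | .top => Set.univ
  | .and φ ψ => M.ext φ ∩ M.ext ψ
  | .or φ ψ => M.ext φ ∪ M.ext ψ
  | .imp φ ψ => (M.ext φ)ᶜ ∪ M.ext ψ
  | .cf φ ψ => {w | ⋃₀ M.sph w ∩ M.ext φ = ∅ ∨
      ∃ X ∈ M.sph w, (X ∩ M.ext φ).Nonempty ∧ X ∩ M.ext φ ⊆ M.ext ψ}

/-- Truth of a set of formulas at a world. -/
def Sat (M : SphereModel.{u}) (w : M.World) (Γ : Set Form) : Prop := ∀ γ ∈ Γ, w ∈ M.ext γ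

/-- Truth of a set of formulas at all worlds. -/
def Valid (M : SphereModel.{u}) (Γ : Set Form) : Prop := ∀ w, M.Sat w Γ

def Normal (M : SphereModel.{u}) : Prop := ∀ w, (⋃₀ M.sph w).Nonempty

def TotallyReflexive (M : SphereModel.{u}) : Prop := ∀ w, w ∈ ⋃₀ M.sph w

def WeaklyCentered (M : SphereModel.{u}) : Prop :=
  ∀ w, (∃ X ∈ M.sph w, X.Nonempty) ∧ ∀ X ∈ M.sph w, X.Nonempty → w ∈ X

def Centered (M : SphereModel.{u}) : Prop := ∀ w, {w} ∈ M.sph w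

def Stalnakerian (M : SphereModel.{u}) : Prop :=
  ∀ w φ, (M.ext φ ∩ ⋃₀ M.sph w).Nonempty → ∃ X ∈ M.sph w, ∃ y, M.ext φ ∩ X = {y}

def Uniform (M : SphereModel.{u}) : Prop := ∀ w v, ⋃₀ M.sph w = ⋃₀ M.sph v

def Absolute (M : SphereModel.{u}) : Prop := ∀ w v, M.sph w = M.sph v

/-- The condition on sphere models that corresponds to an optional axiom. -/
def Condition (M : SphereModel.{u}) : AxName → Prop
  | .W => M.WeaklyCentered
  | .C => M.Centered
  | .N => M.Normal
  | .T => M.TotallyReflexive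
  | .S => M.Stalnakerian
  | .U => M.Uniform
  | .A => M.Absolute

end SphereModel

/-- The class `K_Σ` of sphere models that satisfy all the conditions corresponding to `Σ`. -/
def KClass (Sig : Set AxName) : Set SphereModel.{u} := {M | ∀ a ∈ Sig, M.Condition a}

/-- Global consequence over a class `K` of sphere models. -/
def GlobalConsequence (K : Set SphereModel.{u}) (Γ : Set Form) (φ : Form) : Prop :=
  ∀ M ∈ K, M.Valid Γ → M.Valid {φ}

end Lewis

/-!
Soundness is an induction on derivations. Completeness comes from a canonical model
(`canonicalModel`), whose worlds are the complete consistent theories over the set of formulas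
derivable from `Γ`. Since that set is closed under the rule C, all of its elements are true at all
worlds, so `Γ` is valid in the model; and by Lindenbaum's lemma (`gvProves_of_forall_mem`) a
formula that is not derivable from `Γ` is false at some world.

The spheres around a world `w` come from the comparative possibility that `w` describes. A cut of
`w` (`IsCut`) is a final segment `Q` of that order, a set of formulas each strictly less possible
than each formula outside, and its sphere consists of the worlds that verify no formula of `Q`.
Two cuts of `w` are nested, hence so are their spheres; and a cut is an ideal, so that its sphere
meets every formula outside of it (`IsCut.exists_isWorld`). For a possible formula `φ` the
formulas strictly less possible than `φ` form a cut (`IsWorld.isCut_lessPossible`); L3 enters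
here, through rational monotonicity (`IsWorld.cf_rational`). In the sphere of this cut, the
worlds that verify `φ` verify every `ψ` with `φ □→ ψ` in `w`. The truth lemma
(`canonicalModel.mem_ext`) follows.

Cuts need not be given by single formulas, so there are enough spheres for the optional axioms: C
makes the formulas false at `w` a cut, with sphere `{w}`, and under S only one world of the sphere
of the formulas less possible than `φ` verifies `φ`. The axioms U and A make the impossible
formulas, respectively comparative possibility, the same at `w` and at the worlds of its spheres.
The conditions for U and A compare all worlds of the model, and for these the worlds of the
canonical model are restricted to those that agree with a given one (`Agrees`).
-/

namespace Lewis

open Form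

/-! ### Soundness -/

namespace SphereModel

variable (M : SphereModel.{u}) (w : M.World) (φ ψ : Form)

@[simp] theorem mem_ext_top : w ∈ M.ext top := Set.mem_univ w

@[simp] theorem notMem_ext_bot : w ∉ M.ext bot := Set.notMem_empty w

@[simp] theorem mem_ext_and : w ∈ M.ext (φ ⋏ ψ) ↔ w ∈ M.ext φ ∧ w ∈ M.ext ψ := Iff.rfl

@[simp] theorem mem_ext_or : w ∈ M.ext (φ ⋎ ψ) ↔ w ∈ M.ext φ ∨ w ∈ M.ext ψ := Iff.rfl

@[simp] theorem mem_ext_imp : w ∈ M.ext (φ ⇾ ψ) ↔ (w ∈ M.ext φ → w ∈ M.ext ψ) :=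
  imp_iff_not_or.symm

@[simp] theorem mem_ext_neg : w ∈ M.ext (neg φ) ↔ w ∉ M.ext φ := by simp [neg]

@[simp] theorem mem_ext_iff : w ∈ M.ext (iff φ ψ) ↔ (w ∈ M.ext φ ↔ w ∈ M.ext ψ) := by
  simp [Form.iff, iff_iff_implies_and_implies]

theorem mem_ext_cf : w ∈ M.ext (φ □→ ψ) ↔ (∀ X ∈ M.sph w, ∀ x ∈ X, x ∉ M.ext φ) ∨
    ∃ X ∈ M.sph w, (∃ x ∈ X, x ∈ M.ext φ) ∧ ∀ x ∈ X, x ∈ M.ext φ → x ∈ M.ext ψ := by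
  have h : ⋃₀ M.sph w ∩ M.ext φ = ∅ ↔ ∀ X ∈ M.sph w, ∀ x ∈ X, x ∉ M.ext φ := by
    rw [← Set.disjoint_iff_inter_eq_empty, Set.disjoint_left]
    exact ⟨fun h X hX x hx => h ⟨X, hX, hx⟩, fun h x ⟨X, hX, hx⟩ => h X hX x hx⟩
  rw [← h]
  exact or_congr Iff.rfl (exists_congr fun X => and_congr Iff.rfl
    (and_congr Iff.rfl ⟨fun h x hx hφ => h ⟨hx, hφ⟩, fun h x hx => h x hx.1 hx.2⟩))

theorem mem_ext_box : w ∈ M.ext (box φ) ↔ ∀ x ∈ ⋃₀ M.sph w, x ∈ M.ext φ := by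
  rw [box, mem_ext_cf]
  simp only [mem_ext_neg, not_not]
  constructor
  · rintro (h | ⟨X, -, ⟨x, hx, hn⟩, h⟩) y ⟨Y, hY, hy⟩
    · exact h Y hY y hy
    · exact absurd (h x hx hn) hn
  · exact fun h => Or.inl fun X hX x hx => h x ⟨X, hX, hx⟩

theorem mem_ext_dia : w ∈ M.ext (dia φ) ↔ ∃ x ∈ ⋃₀ M.sph w, x ∈ M.ext φ := by
  rw [dia, mem_ext_neg, mem_ext_box]
  simp only [mem_ext_neg, not_forall, not_not, exists_prop]

/-- Comparative possibility at a world depends on the spheres around it only. -/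
theorem mem_ext_preceq_congr {w v : M.World} (h : M.sph w = M.sph v) :
    w ∈ M.ext (preceq φ ψ) ↔ v ∈ M.ext (preceq φ ψ) := by
  simp only [preceq, might, mem_ext_imp, mem_ext_neg, mem_ext_cf, h]

variable {M w}

theorem subset_or_subset {X Y : Set M.World} (hX : X ∈ M.sph w) (hY : Y ∈ M.sph w) :
    X ⊆ Y ∨ Y ⊆ X :=
  (M.nested w X hX Y hY).imp And.right And.right

variable {φ ψ}

theorem mem_ext_of_classicalAxiom (h : ClassicalAxiom φ) : w ∈ M.ext φ := by
  cases h <;> simp <;> tauto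

theorem mem_ext_l2 (γ : Form) (h₁ : w ∈ M.ext (φ □→ ψ)) (h₂ : w ∈ M.ext (ψ □→ φ))
    (h : w ∈ M.ext (φ □→ γ)) : w ∈ M.ext (ψ □→ γ) := by
  rw [mem_ext_cf] at *
  rcases h₂ with h₂ | ⟨Y, hY, ⟨y, hy, hyψ⟩, hYs⟩
  · exact Or.inl h₂
  rcases h with h | ⟨Z, hZ, ⟨z, hz, hzφ⟩, hZs⟩
  · exact absurd (hYs y hy hyψ) (h Y hY y hy)
  rcases h₁ with h₁ | ⟨X, hX, ⟨x, hx, hxφ⟩, hXs⟩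
  · exact absurd hzφ (h₁ Z hZ z hz)
  refine Or.inr ?_
  rcases subset_or_subset hY hZ with hYZ | hZY
  · exact ⟨Y, hY, ⟨y, hy, hyψ⟩, fun t ht htψ => hZs t (hYZ ht) (hYs t ht htψ)⟩
  refine ⟨Z, hZ, ?_, fun t ht htψ => hZs t ht (hYs t (hZY ht) htψ)⟩
  rcases subset_or_subset hX hZ with hXZ | hZX
  · exact ⟨x, hXZ hx, hXs x hx hxφ⟩
  · exact ⟨z, hz, hXs z (hZX hz) hzφ⟩

theorem mem_ext_l3 (φ ψ γ : Form) (h₁ : w ∉ M.ext ((φ ⋎ ψ) □→ φ))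
    (h₂ : w ∉ M.ext ((φ ⋎ ψ) □→ ψ)) :
    w ∈ M.ext ((φ ⋎ ψ) □→ γ) ↔ w ∈ M.ext (φ □→ γ) ∧ w ∈ M.ext (ψ □→ γ) := by
  simp only [mem_ext_cf, mem_ext_or, not_or, not_exists, not_and, not_forall] at *
  obtain ⟨⟨X₀, hX₀, x₀, hx₀, hφψ⟩, h₁⟩ := h₁
  replace h₁ : ∀ X ∈ M.sph w, ∀ x ∈ X, (x ∈ M.ext φ ∨ x ∈ M.ext ψ) → ∃ y ∈ X, y ∈ M.ext ψ := by
    intro X hX x hx h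
    obtain ⟨y, hy, hy', hyn⟩ := h₁ X hX ⟨x, hx, h⟩
    exact ⟨y, hy, hy'.resolve_left hyn⟩
  replace h₂ : ∀ X ∈ M.sph w, ∀ x ∈ X, (x ∈ M.ext φ ∨ x ∈ M.ext ψ) → ∃ y ∈ X, y ∈ M.ext φ := by
    intro X hX x hx h
    obtain ⟨y, hy, hy', hyn⟩ := h₂.2 X hX ⟨x, hx, h⟩
    exact ⟨y, hy, hy'.resolve_right hyn⟩
  have hor : x₀ ∈ M.ext φ ∨ x₀ ∈ M.ext ψ := by tauto
  obtain ⟨p, hp, hpψ⟩ := h₁ X₀ hX₀ x₀ hx₀ hor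
  obtain ⟨q, hq, hqφ⟩ := h₂ X₀ hX₀ x₀ hx₀ hor
  constructor
  · rintro (h | ⟨X, hX, ⟨x, hx, hxφψ⟩, hXs⟩)
    · exact absurd hpψ (h X₀ hX₀ p hp).2
    · exact ⟨Or.inr ⟨X, hX, h₂ X hX x hx hxφψ, fun t ht h => hXs t ht (Or.inl h)⟩,
        Or.inr ⟨X, hX, h₁ X hX x hx hxφψ, fun t ht h => hXs t ht (Or.inr h)⟩⟩
  · rintro ⟨h | ⟨X, hX, ⟨x, hx, hxφ⟩, hXs⟩, h' | ⟨Y, hY, ⟨y, hy, hyψ⟩, hYs⟩⟩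
    · exact absurd hqφ (h X₀ hX₀ q hq)
    · exact absurd hqφ (h X₀ hX₀ q hq)
    · exact absurd hpψ (h' X₀ hX₀ p hp)
    · refine Or.inr ?_
      rcases subset_or_subset hX hY with hXY | hYX
      · exact ⟨X, hX, ⟨x, hx, Or.inl hxφ⟩, fun t ht h => h.elim (hXs t ht) (hYs t (hXY ht))⟩
      · exact ⟨Y, hY, ⟨y, hy, Or.inr hyψ⟩, fun t ht h => h.elim (hXs t (hYX ht)) (hYs t ht)⟩

theorem mem_ext_cf_and (φ ψ γ : Form) :
    w ∈ M.ext (φ □→ (ψ ⋏ γ)) ↔ w ∈ M.ext (φ □→ ψ) ∧ w ∈ M.ext (φ □→ γ) := by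
  simp only [mem_ext_cf, mem_ext_and]
  constructor
  · rintro (h | ⟨X, hX, hx, hXs⟩)
    · exact ⟨Or.inl h, Or.inl h⟩
    · exact ⟨Or.inr ⟨X, hX, hx, fun t ht h => (hXs t ht h).1⟩,
        Or.inr ⟨X, hX, hx, fun t ht h => (hXs t ht h).2⟩⟩
  · rintro ⟨h | ⟨X, hX, hx, hXs⟩, h' | ⟨Y, hY, hy, hYs⟩⟩
    · exact Or.inl h
    · exact Or.inl h
    · exact Or.inl h'
    · refine Or.inr ?_
      rcases subset_or_subset hX hY with hXY | hYX
      · exact ⟨X, hX, hx, fun t ht h => ⟨hXs t ht h, hYs t (hXY ht) h⟩⟩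
      · exact ⟨Y, hY, hy, fun t ht h => ⟨hXs t (hYX ht) h, hYs t ht h⟩⟩

theorem mem_ext_of_baseAxiom (h : BaseAxiom φ) : w ∈ M.ext φ := by
  cases h with
  | classical h => exact mem_ext_of_classicalAxiom h
  | l1 φ =>
    rw [mem_ext_cf, or_iff_not_imp_left]
    intro h
    push Not at h
    obtain ⟨X, hX, hx⟩ := h
    exact ⟨X, hX, hx, fun _ _ h => h⟩
  | l2 φ ψ γ =>
    rw [mem_ext_imp, mem_ext_and, mem_ext_iff]
    exact fun h => ⟨mem_ext_l2 γ h.1 h.2, mem_ext_l2 γ h.2 h.1⟩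
  | l3 φ ψ γ =>
    rw [mem_ext_or, mem_ext_or, mem_ext_iff, mem_ext_and, or_iff_not_imp_left,
      or_iff_not_imp_left]
    exact mem_ext_l3 φ ψ γ
  | l4 φ ψ γ =>
    rw [mem_ext_iff, mem_ext_and]
    exact mem_ext_cf_and φ ψ γ

/-- Modus ponens for the counterfactual holds at a world that lies in all its spheres. -/
theorem WeaklyCentered.mem_ext (h : M.WeaklyCentered) (h₁ : w ∈ M.ext (φ □→ ψ))
    (h₂ : w ∈ M.ext φ) : w ∈ M.ext ψ := by
  obtain ⟨⟨X, hX, hne⟩, hall⟩ := h w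
  rcases (M.mem_ext_cf w φ ψ).1 h₁ with h₁ | ⟨Y, hY, ⟨y, hy, -⟩, hYs⟩
  · exact absurd h₂ (h₁ X hX w (hall X hX hne))
  · exact hYs w (hall Y hY ⟨y, hy⟩) h₂

theorem Centered.weaklyCentered (h : M.Centered) : M.WeaklyCentered := by
  refine fun w => ⟨⟨{w}, h w, Set.singleton_nonempty w⟩, fun X hX hne => ?_⟩
  rcases subset_or_subset hX (h w) with hs | hs
  · obtain ⟨x, hx⟩ := hne
    obtain rfl : x = w := hs hx
    exact hx
  · exact hs rfl

theorem mem_ext_of_extraAxiom {a : AxName} (hM : M.Condition a) (h : ExtraAxiom a φ) :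
    w ∈ M.ext φ := by
  cases h with
  | W φ ψ =>
    rw [mem_ext_imp, mem_ext_imp]
    exact WeaklyCentered.mem_ext hM
  | C φ ψ =>
    simp only [mem_ext_and, mem_ext_imp]
    refine ⟨hM.weaklyCentered.mem_ext, fun h => (M.mem_ext_cf w φ ψ).2 (Or.inr ?_)⟩
    refine ⟨{w}, hM w, ⟨w, rfl, h.1⟩, ?_⟩
    rintro x rfl -
    exact h.2
  | N φ =>
    rw [mem_ext_imp, mem_ext_box, mem_ext_dia]
    obtain ⟨x, hx⟩ := hM w
    exact fun h => ⟨x, hx, h x hx⟩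
  | T φ =>
    rw [mem_ext_imp, mem_ext_box]
    exact fun h => h w (hM w)
  | S φ ψ =>
    rw [mem_ext_or]
    by_cases hne : (M.ext φ ∩ ⋃₀ M.sph w).Nonempty
    · obtain ⟨X, hX, y, hy⟩ := hM w φ hne
      have hy' : y ∈ M.ext φ ∩ X := hy ▸ rfl
      have huniq : ∀ x ∈ X, x ∈ M.ext φ → x = y := fun x hx hxφ => by
        have : x ∈ M.ext φ ∩ X := ⟨hxφ, hx⟩
        rwa [hy] at this
      simp only [mem_ext_cf]
      by_cases hyψ : y ∈ M.ext ψ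
      · refine Or.inl (Or.inr ⟨X, hX, ⟨y, hy'.2, hy'.1⟩, fun x hx hxφ => ?_⟩)
        rwa [huniq x hx hxφ]
      · refine Or.inr (Or.inr ⟨X, hX, ⟨y, hy'.2, hy'.1⟩, fun x hx hxφ => ?_⟩)
        rwa [huniq x hx hxφ, mem_ext_neg]
    · exact Or.inl ((M.mem_ext_cf w φ ψ).2 (Or.inl fun X hX x hx hxφ =>
        hne ⟨x, hxφ, X, hX, hx⟩))
  | U φ =>
    have hM : M.Uniform := hM
    simp only [mem_ext_and, mem_ext_imp, mem_ext_box, mem_ext_dia]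
    exact ⟨fun h x _ => hM w x ▸ h, fun h x _ => hM w x ▸ h⟩
  | A φ ψ =>
    have hM : M.Absolute := hM
    simp only [mem_ext_and, mem_ext_imp, mem_ext_box, prec, mem_ext_neg]
    exact ⟨fun h x _ => (M.mem_ext_preceq_congr _ _ (hM w x)).1 h,
      fun h x _ => (M.mem_ext_preceq_congr _ _ (hM w x)).not.1 h⟩

end SphereModel

open SphereModel in
theorem GVProves.sound {Sig : Set AxName} {Γ : Set Form} {φ : Form} (d : GVProves Sig Γ φ)
    {M : SphereModel.{u}} (hM : M ∈ KClass Sig) (hΓ : M.Valid Γ) (w : M.World) :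
    w ∈ M.ext φ := by
  induction d generalizing w with
  | hyp m => exact hΓ w _ m
  | base h => exact mem_ext_of_baseAxiom h
  | extra ha h => exact mem_ext_of_extraAxiom (hM _ ha) h
  | mp _ _ ih₁ ih₂ => exact (mem_ext_imp ..).1 (ih₂ w) (ih₁ w)
  | ruleC γ _ ih =>
    rw [mem_ext_imp, mem_ext_cf, mem_ext_cf]
    refine Or.imp_right fun ⟨X, hX, hx, hXs⟩ => ⟨X, hX, hx, fun x hx hxγ => ?_⟩
    exact (mem_ext_imp ..).1 (ih x) (hXs x hx hxγ)

/-! ### Theories and Lindenbaum's lemma -/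

/-- A set of formulas that contains the consequences of `Γ` in `GVΣ` and is closed under modus
ponens. It need not be closed under the rule C. -/
structure IsTheory (Sig : Set AxName) (Γ T : Set Form) : Prop where
  of_proves : ∀ {φ}, GVProves Sig Γ φ → φ ∈ T
  mp : ∀ {φ ψ}, φ ⇾ ψ ∈ T → φ ∈ T → ψ ∈ T

/-- A world of the canonical model: a complete and consistent theory. -/
structure IsWorld (Sig : Set AxName) (Γ w : Set Form) : Prop extends IsTheory Sig Γ w where
  bot_notMem : bot ∉ w
  mem_or_neg_mem : ∀ φ, φ ∈ w ∨ neg φ ∈ w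

variable {Sig : Set AxName} {Γ : Set Form}

theorem IsTheory.of_classicalAxiom {T : Set Form} (hT : IsTheory Sig Γ T) {φ : Form}
    (h : ClassicalAxiom φ) : φ ∈ T :=
  hT.of_proves (.base (.classical h))

/-- The theory generated by a theory and one more formula. -/
theorem IsTheory.adjoin {T : Set Form} (hT : IsTheory Sig Γ T) (θ : Form) :
    IsTheory Sig Γ {ψ | θ ⇾ ψ ∈ T} where
  of_proves h := hT.mp (hT.of_classicalAxiom (.k _ _)) (hT.of_proves h)
  mp h₁ h₂ := hT.mp (hT.mp (hT.of_classicalAxiom (.s _ _ _)) h₁) h₂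

theorem IsTheory.subset_adjoin {T : Set Form} (hT : IsTheory Sig Γ T) (θ : Form) :
    T ⊆ {ψ | θ ⇾ ψ ∈ T} :=
  fun _ h => hT.mp (hT.of_classicalAxiom (.k _ _)) h

theorem IsTheory.imp_self_mem {T : Set Form} (hT : IsTheory Sig Γ T) (θ : Form) : θ ⇾ θ ∈ T :=
  hT.mp (hT.mp (hT.of_classicalAxiom (.s θ (θ ⇾ θ) θ)) (hT.of_classicalAxiom (.k _ _)))
    (hT.of_classicalAxiom (.k _ _))

/-- Lindenbaum's lemma. -/
theorem IsTheory.exists_isWorld {T : Set Form} (hT : IsTheory Sig Γ T) (hbot : bot ∉ T) :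
    ∃ w, IsWorld Sig Γ w ∧ T ⊆ w := by
  obtain ⟨w, hTw, ⟨hw, hwbot⟩, hmax⟩ :=
    zorn_subset_nonempty {U | IsTheory Sig Γ U ∧ bot ∉ U} (fun c hc hchain ⟨U, hU⟩ => by
      refine ⟨⋃₀ c, ⟨⟨fun h => ⟨U, hU, (hc hU).1.of_proves h⟩, ?_⟩, ?_⟩,
        fun s hs => Set.subset_sUnion_of_mem hs⟩
      · rintro φ ψ ⟨A, hA, h₁⟩ ⟨B, hB, h₂⟩
        rcases hchain.total hA hB with h | h
        · exact ⟨B, hB, (hc hB).1.mp (h h₁) h₂⟩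
        · exact ⟨A, hA, (hc hA).1.mp h₁ (h h₂)⟩
      · rintro ⟨A, hA, h⟩
        exact (hc hA).2 h) T ⟨hT, hbot⟩
  refine ⟨w, ⟨hw, hwbot, fun φ => or_iff_not_imp_right.2 fun hn => ?_⟩, hTw⟩
  exact hmax ⟨hw.adjoin φ, hn⟩ (hw.subset_adjoin φ) (hw.imp_self_mem φ)

/-- A formula that belongs to all worlds is derivable. It reduces derivations in classical
propositional logic to truth tables. -/
theorem gvProves_of_forall_mem {φ : Form} (h : ∀ w, IsWorld Sig Γ w → φ ∈ w) :
    GVProves Sig Γ φ := by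
  have hL : IsTheory Sig Γ {ψ | GVProves Sig Γ ψ} := ⟨id, fun h₁ h₂ => .mp h₂ h₁⟩
  by_contra hφ
  obtain ⟨w, hw, hsub⟩ := (hL.adjoin (neg φ)).exists_isWorld
    fun hn => hφ (hL.mp (hL.of_classicalAxiom (.dne φ)) hn)
  exact hw.bot_notMem (hw.mp (hsub (hL.imp_self_mem (neg φ))) (h w hw))

namespace IsWorld

variable {w v : Set Form} {φ ψ χ γ θ : Form}

theorem mem_imp (hw : IsWorld Sig Γ w) : φ ⇾ ψ ∈ w ↔ (φ ∈ w → ψ ∈ w) := by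
  refine ⟨hw.mp, fun h => ?_⟩
  rcases hw.mem_or_neg_mem φ with hφ | hφ
  · exact hw.subset_adjoin φ (h hφ)
  · exact (hw.adjoin φ).mp (hw.subset_adjoin φ (hw.of_classicalAxiom (.efq ψ))) hφ

theorem mem_neg (hw : IsWorld Sig Γ w) : neg φ ∈ w ↔ φ ∉ w :=
  hw.mem_imp.trans (by simp [hw.bot_notMem])

theorem mem_and (hw : IsWorld Sig Γ w) : φ ⋏ ψ ∈ w ↔ φ ∈ w ∧ ψ ∈ w :=
  ⟨fun h => ⟨hw.mp (hw.of_classicalAxiom (.and_left φ ψ)) h,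
    hw.mp (hw.of_classicalAxiom (.and_right φ ψ)) h⟩,
    fun h => hw.mp (hw.mp (hw.of_classicalAxiom (.and_intro φ ψ)) h.1) h.2⟩

theorem mem_or (hw : IsWorld Sig Γ w) : φ ⋎ ψ ∈ w ↔ φ ∈ w ∨ ψ ∈ w := by
  refine ⟨fun h => ?_, fun h => h.elim (hw.mp (hw.of_classicalAxiom (.or_left φ ψ)))
    (hw.mp (hw.of_classicalAxiom (.or_right φ ψ)))⟩
  by_contra! hn
  exact hw.bot_notMem (hw.mp (hw.mp (hw.mp (hw.of_classicalAxiom (.or_elim φ ψ bot))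
    (hw.mem_neg.2 hn.1)) (hw.mem_neg.2 hn.2)) h)

theorem mem_iff (hw : IsWorld Sig Γ w) : Form.iff φ ψ ∈ w ↔ (φ ∈ w ↔ ψ ∈ w) := by
  rw [Form.iff, hw.mem_and, hw.mem_imp, hw.mem_imp]
  exact iff_def.symm

theorem top_mem (hw : IsWorld Sig Γ w) : top ∈ w := hw.of_classicalAxiom .verum

theorem eq_of_subset (hw : IsWorld Sig Γ w) (hv : IsWorld Sig Γ v) (h : v ⊆ w) : v = w :=
  h.antisymm fun _ hφ => by_contra fun hn => hw.mem_neg.1 (h (hv.mem_neg.2 hn)) hφ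

/-! ### Conditional logic inside a world -/

theorem cf_mono (hw : IsWorld Sig Γ w) (h : ∀ v, IsWorld Sig Γ v → φ ∈ v → ψ ∈ v)
    (hφ : γ □→ φ ∈ w) : γ □→ ψ ∈ w :=
  hw.mp (hw.of_proves (.ruleC γ (gvProves_of_forall_mem fun v hv => hv.mem_imp.2 (h v hv)))) hφ

theorem cf_and (hw : IsWorld Sig Γ w) (hφ : γ □→ φ ∈ w) (hψ : γ □→ ψ ∈ w) :
    γ □→ (φ ⋏ ψ) ∈ w :=
  (hw.mem_iff.1 (hw.of_proves (.base (.l4 γ φ ψ)))).2 (hw.mem_and.2 ⟨hφ, hψ⟩)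

theorem cf_of_forall (hw : IsWorld Sig Γ w) (h : ∀ v, IsWorld Sig Γ v → γ ∈ v → φ ∈ v) :
    γ □→ φ ∈ w :=
  hw.cf_mono h (hw.of_proves (.base (.l1 γ)))

/-- The consequents of a counterfactual with antecedent `γ` are closed under consequence, with `γ`
as an additional premise. -/
theorem cf_mono₂ (hw : IsWorld Sig Γ w) (hφ : γ □→ φ ∈ w) (hψ : γ □→ ψ ∈ w)
    (h : ∀ v, IsWorld Sig Γ v → γ ∈ v → φ ∈ v → ψ ∈ v → θ ∈ v) : γ □→ θ ∈ w := by
  refine hw.cf_mono (fun v hv hm => ?_)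
    (hw.cf_and (hw.cf_of_forall fun _ _ => id) (hw.cf_and hφ hψ))
  rw [hv.mem_and, hv.mem_and] at hm
  exact h v hv hm.1 hm.2.1 hm.2.2

theorem cf_mono₁ (hw : IsWorld Sig Γ w) (hφ : γ □→ φ ∈ w)
    (h : ∀ v, IsWorld Sig Γ v → γ ∈ v → φ ∈ v → θ ∈ v) : γ □→ θ ∈ w :=
  hw.cf_mono₂ hφ hφ fun v hv h₁ h₂ _ => h v hv h₁ h₂

/-- Antecedents that counterfactually imply each other are interchangeable. -/
theorem cf_trade (hw : IsWorld Sig Γ w) (h₁ : φ □→ ψ ∈ w) (h₂ : ψ □→ φ ∈ w)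
    (h : φ □→ γ ∈ w) : ψ □→ γ ∈ w :=
  (hw.mem_iff.1 (hw.mp (hw.of_proves (.base (.l2 φ ψ γ))) (hw.mem_and.2 ⟨h₁, h₂⟩))).1 h

theorem cf_congr_left (hw : IsWorld Sig Γ w) (h : ∀ v, IsWorld Sig Γ v → (φ ∈ v ↔ ψ ∈ v))
    (hφ : φ □→ γ ∈ w) : ψ □→ γ ∈ w :=
  hw.cf_trade (hw.cf_of_forall fun v hv => (h v hv).1) (hw.cf_of_forall fun v hv => (h v hv).2) hφ

/-- The trichotomy given by L3. -/
theorem cf_or_cases (hw : IsWorld Sig Γ w) (φ ψ γ : Form) :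
    (φ ⋎ ψ) □→ φ ∈ w ∨ (φ ⋎ ψ) □→ ψ ∈ w ∨
      ((φ ⋎ ψ) □→ γ ∈ w ↔ φ □→ γ ∈ w ∧ ψ □→ γ ∈ w) := by
  have h := hw.of_proves (.base (.l3 φ ψ γ))
  rwa [hw.mem_or, hw.mem_or, hw.mem_iff, hw.mem_and] at h

theorem cf_or (hw : IsWorld Sig Γ w) (hφ : φ □→ γ ∈ w) (hψ : ψ □→ γ ∈ w) :
    (φ ⋎ ψ) □→ γ ∈ w := by
  rcases hw.cf_or_cases φ ψ γ with h | h | h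
  · exact hw.cf_trade (hw.cf_of_forall fun v hv h => hv.mem_or.2 (Or.inl h)) h hφ
  · exact hw.cf_trade (hw.cf_of_forall fun v hv h => hv.mem_or.2 (Or.inr h)) h hψ
  · exact h.2 ⟨hφ, hψ⟩

/-- Rational monotonicity: an antecedent can be strengthened to `φ` if it does not counterfactually
exclude `φ`. -/
theorem cf_rational (hw : IsWorld Sig Γ w) (hφψ : ∀ v, IsWorld Sig Γ v → φ ∈ v → ψ ∈ v)
    (hγ : ψ □→ γ ∈ w) (hn : ψ □→ neg φ ∉ w) : φ □→ γ ∈ w := by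
  have hψ : ∀ v, IsWorld Sig Γ v → (ψ ∈ v ↔ φ ⋎ (ψ ⋏ neg φ) ∈ v) := fun v hv => by
    have := hφψ v hv
    rw [hv.mem_or, hv.mem_and, hv.mem_neg]
    tauto
  have hψ' := fun v hv => (hψ v hv).symm
  rcases hw.cf_or_cases φ (ψ ⋏ neg φ) γ with h | h | h
  · exact hw.cf_trade (hw.cf_congr_left hψ' h) (hw.cf_of_forall hφψ) hγ
  · exact absurd (hw.cf_mono (fun v hv h => (hv.mem_and.1 h).2) (hw.cf_congr_left hψ' h)) hn
  · exact (h.1 (hw.cf_congr_left hψ hγ)).1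

theorem cf_of_cf_bot (hw : IsWorld Sig Γ w) (h : φ □→ bot ∈ w) : φ □→ ψ ∈ w :=
  hw.cf_mono (fun _ hv h => absurd h hv.bot_notMem) h

theorem cf_bot_of_cf_neg_self (hw : IsWorld Sig Γ w) (h : φ □→ neg φ ∈ w) : φ □→ bot ∈ w :=
  hw.cf_mono₁ h fun _ hv h₁ h₂ => absurd h₁ (hv.mem_neg.1 h₂)

theorem cf_bot_anti (hw : IsWorld Sig Γ w) (hφψ : ∀ v, IsWorld Sig Γ v → φ ∈ v → ψ ∈ v)
    (h : ψ □→ bot ∈ w) : φ □→ bot ∈ w :=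
  hw.cf_trade (hw.cf_of_cf_bot h) (hw.cf_of_forall hφψ) h

/-- The negation of an impossible formula is a consequent of every counterfactual. -/
theorem cf_neg_of_cf_bot (hw : IsWorld Sig Γ w) (h : χ □→ bot ∈ w) : γ □→ neg χ ∈ w := by
  -- split `γ` into its impossible part `γ ⋏ χ` and the part `γ ⋏ neg χ`, where the claim is clear
  refine hw.cf_congr_left (φ := γ ⋏ χ ⋎ γ ⋏ neg χ) (fun v hv => ?_) (hw.cf_or ?_ ?_)
  · rw [hv.mem_or, hv.mem_and, hv.mem_and, hv.mem_neg]
    tauto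
  · exact hw.cf_of_cf_bot (hw.cf_bot_anti (fun v hv h => (hv.mem_and.1 h).2) h)
  · exact hw.cf_of_forall fun v hv h => (hv.mem_and.1 h).2

theorem box_mem (hw : IsWorld Sig Γ w) : box φ ∈ w ↔ neg φ □→ bot ∈ w :=
  ⟨fun h => hw.cf_mono₁ h fun _ hv h₁ h₂ => absurd h₂ (hv.mem_neg.1 h₁), hw.cf_of_cf_bot⟩

theorem dia_mem (hw : IsWorld Sig Γ w) : dia φ ∈ w ↔ φ □→ bot ∉ w := by
  rw [dia, hw.mem_neg, hw.box_mem, not_iff_not]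
  have h : ∀ v, IsWorld Sig Γ v → (neg (neg φ) ∈ v ↔ φ ∈ v) := fun v hv => by
    rw [hv.mem_neg, hv.mem_neg, not_not]
  exact ⟨hw.cf_congr_left h, hw.cf_congr_left fun v hv => (h v hv).symm⟩

/-- Comparative possibility determines which formulas are impossible. -/
theorem cf_bot_mem_iff_preceq (hw : IsWorld Sig Γ w) : φ □→ bot ∈ w ↔ preceq bot φ ∈ w := by
  have h : ∀ v, IsWorld Sig Γ v → (φ ∈ v ↔ bot ⋎ φ ∈ v) := fun v hv => by
    rw [hv.mem_or, or_iff_right hv.bot_notMem]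
  have hbot : (bot ⋎ φ) □→ neg bot ∈ w :=
    hw.cf_of_forall fun v hv _ => hv.mem_neg.2 hv.bot_notMem
  simp only [preceq, might, hw.mem_imp, hw.mem_neg, hbot, not_true, imp_false, not_not]
  exact ⟨fun h' => hw.cf_of_cf_bot (hw.cf_congr_left h h'), fun h' =>
    hw.cf_congr_left (fun v hv => (h v hv).symm) (hw.cf_bot_of_cf_neg_self h')⟩

theorem cf_neg_mem_iff_preceq (hw : IsWorld Sig Γ w) :
    (φ ⋎ ψ) □→ neg φ ∈ w ↔ (φ ⋎ ψ) □→ bot ∈ w ∨ preceq φ ψ ∉ w := by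
  simp only [preceq, might, hw.mem_imp, hw.mem_neg, Classical.not_imp, not_not]
  refine ⟨fun h => or_iff_not_imp_left.2 fun hn =>
    ⟨fun h' => hn (hw.cf_bot_of_cf_neg_self h'), h⟩, fun h => h.elim hw.cf_of_cf_bot And.right⟩

end IsWorld

/-! ### Cuts and canonical spheres -/

/-- The formulas that are impossible at the world `w`. -/
def impossible (w : Set Form) : Set Form := {χ | χ □→ bot ∈ w}

/-- The formulas that are impossible or strictly less possible than `φ` at the world `w`. -/
def lessPossible (w : Set Form) (φ : Form) : Set Form := {χ | (φ ⋎ χ) □→ neg χ ∈ w}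

/-- A cut of the world `w`: a proper final segment, with respect to comparative possibility at `w`,
of the formulas that contains the impossible ones. Each formula `ψ` of the cut is strictly less
possible than each formula `χ` outside, which is to say that `(ψ ⋎ χ) □→ neg ψ`. -/
structure IsCut (w Q : Set Form) : Prop where
  mem_of_cf_bot : ∀ {ψ}, ψ □→ bot ∈ w → ψ ∈ Q
  top_notMem : top ∉ Q
  cf_neg_mem : ∀ {ψ χ}, ψ ∈ Q → χ ∉ Q → (ψ ⋎ χ) □→ neg ψ ∈ w

namespace IsCut

variable {w v Q R : Set Form} {φ ψ χ γ θ : Form}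

theorem subset_or_subset (hw : IsWorld Sig Γ w) (hQ : IsCut w Q) (hR : IsCut w R) :
    Q ⊆ R ∨ R ⊆ Q := by
  by_contra! h
  obtain ⟨⟨ψ, hψQ, hψR⟩, χ, hχR, hχQ⟩ := h.imp Set.not_subset.1 Set.not_subset.1
  -- each of `ψ` and `χ` is strictly less possible than the other, so both are impossible
  refine hψR (hR.mem_of_cf_bot (hw.cf_bot_anti (ψ := ψ ⋎ χ)
    (fun v hv h => hv.mem_or.2 (Or.inl h)) ?_))
  refine hw.cf_mono₂ (hQ.cf_neg_mem hψQ hχQ) (hw.cf_congr_left (fun v hv => ?_)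
    (hR.cf_neg_mem hχR hψR)) fun v hv h h₁ h₂ => ?_
  · rw [hv.mem_or, hv.mem_or, or_comm]
  · rw [hv.mem_or] at h
    exact (h.elim (hv.mem_neg.1 h₁) (hv.mem_neg.1 h₂)).elim

theorem mem_of_forall (hw : IsWorld Sig Γ w) (hQ : IsCut w Q)
    (h : ∀ v, IsWorld Sig Γ v → φ ∈ v → ψ ∈ v) (hψ : ψ ∈ Q) : φ ∈ Q := by
  by_contra hφ
  refine hφ (hQ.mem_of_cf_bot (hw.cf_bot_anti h (hw.cf_bot_of_cf_neg_self ?_)))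
  refine hw.cf_congr_left (fun v hv => ?_) (hQ.cf_neg_mem hψ hφ)
  rw [hv.mem_or, or_iff_left_of_imp (h v hv)]

theorem or_mem (hw : IsWorld Sig Γ w) (hQ : IsCut w Q) (hφ : φ ∈ Q) (hψ : ψ ∈ Q) :
    φ ⋎ ψ ∈ Q := by
  by_contra h
  refine h (hQ.mem_of_cf_bot (hw.cf_mono₂ (φ := neg φ) (ψ := neg ψ) ?_ ?_
    fun v hv h h₁ h₂ => ?_))
  · refine hw.cf_congr_left (fun v hv => ?_) (hQ.cf_neg_mem hφ h)
    rw [hv.mem_or, hv.mem_or]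
    tauto
  · refine hw.cf_congr_left (fun v hv => ?_) (hQ.cf_neg_mem hψ h)
    rw [hv.mem_or, hv.mem_or]
    tauto
  · rw [hv.mem_or] at h
    exact (h.elim (hv.mem_neg.1 h₁) (hv.mem_neg.1 h₂)).elim

/-- The sphere of a cut meets every formula outside of the cut. -/
theorem exists_isWorld (hw : IsWorld Sig Γ w) (hQ : IsCut w Q) (hφ : φ ∉ Q) :
    ∃ v, IsWorld Sig Γ v ∧ φ ∈ v ∧ Disjoint v Q := by
  -- the theory generated by `φ` and the negations of the formulas of the cut
  let T : Set Form := {θ | ∃ χ ∈ Q, ∀ v, IsWorld Sig Γ v → φ ∈ v → θ ∈ v ∨ χ ∈ v}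
  have hbot : bot ∈ Q := hQ.mem_of_cf_bot (hw.cf_of_forall fun _ _ => id)
  have hT : IsTheory Sig Γ T := by
    refine ⟨fun h => ⟨bot, hbot, fun v hv _ => Or.inl (hv.of_proves h)⟩, ?_⟩
    rintro α β ⟨χ₁, hχ₁, h₁⟩ ⟨χ₂, hχ₂, h₂⟩
    refine ⟨χ₁ ⋎ χ₂, hQ.or_mem hw hχ₁ hχ₂, fun v hv hφ => ?_⟩
    have h₁ := h₁ v hv hφ
    have h₂ := h₂ v hv hφ
    rw [hv.mem_imp] at h₁
    rw [hv.mem_or]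
    tauto
  obtain ⟨v, hv, hTv⟩ := hT.exists_isWorld fun ⟨χ, hχ, h⟩ =>
    hφ (hQ.mem_of_forall hw (fun v hv hφ => (h v hv hφ).resolve_left hv.bot_notMem) hχ)
  refine ⟨v, hv, hTv ⟨bot, hbot, fun v _ h => Or.inl h⟩, Set.disjoint_left.2 fun χ hχv hχ => ?_⟩
  refine hv.mem_neg.1 (hTv ⟨χ, hχ, fun u hu _ => ?_⟩) hχv
  rw [hu.mem_neg]
  exact (em _).symm

/-- The largest sphere is that of the impossible formulas. -/
theorem _root_.Lewis.IsWorld.isCut_impossible (hw : IsWorld Sig Γ w) (h : top □→ bot ∉ w) :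
    IsCut w (impossible w) :=
  ⟨id, h, fun h _ => hw.cf_neg_of_cf_bot h⟩

/-- If `φ` is possible, then the formulas strictly less possible than `φ` form a cut. -/
theorem _root_.Lewis.IsWorld.isCut_lessPossible (hw : IsWorld Sig Γ w) (h : φ □→ bot ∉ w) :
    IsCut w (lessPossible w φ) := by
  refine ⟨hw.cf_neg_of_cf_bot, fun h' => h ?_, fun {ψ χ} hψ hχ => ?_⟩
  · refine hw.cf_bot_anti (fun v hv _ => hv.mem_or.2 (Or.inr hv.top_mem))
      (hw.cf_mono (fun v hv h => absurd hv.top_mem (hv.mem_neg.1 h)) h')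
  · -- this antecedent is equivalent to `φ ⋎ ψ ⋎ χ`, and strengthening it to `ψ ⋎ χ` is licensed
    -- because otherwise `χ` would be strictly less possible than `φ`
    have hα : ((φ ⋎ ψ) ⋎ (χ ⋏ neg ψ)) □→ neg ψ ∈ w :=
      hw.cf_or hψ (hw.cf_of_forall fun v hv h => (hv.mem_and.1 h).2)
    refine hw.cf_rational (fun v hv => ?_) hα fun hn => hχ ?_
    · rw [hv.mem_or, hv.mem_or, hv.mem_or, hv.mem_and, hv.mem_neg]
      tauto
    · refine hw.cf_trade (φ := (φ ⋎ ψ) ⋎ (χ ⋏ neg ψ)) (hw.cf_mono₁ hα fun v hv => ?_)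
        (hw.cf_of_forall fun v hv => ?_) (hw.cf_mono (fun v hv => ?_) hn)
      all_goals simp only [hv.mem_or, hv.mem_and, hv.mem_neg]; tauto

theorem notMem_lessPossible (hw : IsWorld Sig Γ w) (h : φ □→ bot ∉ w) :
    φ ∉ lessPossible w φ := fun h' => h <| hw.cf_bot_of_cf_neg_self <|
  hw.cf_congr_left (fun v hv => by rw [hv.mem_or, or_self]) h'

theorem and_neg_mem_lessPossible (hw : IsWorld Sig Γ w) (h : φ □→ ψ ∈ w) :
    φ ⋏ neg ψ ∈ lessPossible w φ := by
  refine hw.cf_congr_left (fun v hv => ?_) (hw.cf_mono (ψ := neg (φ ⋏ neg ψ)) (fun v hv => ?_) h)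
  all_goals simp only [hv.mem_or, hv.mem_and, hv.mem_neg]; tauto

/-- The sphere of the formulas less possible than `φ` verifies the counterfactuals that `w` has
with antecedent `φ`. -/
theorem mem_of_disjoint_lessPossible (hw : IsWorld Sig Γ w) (hv : IsWorld Sig Γ v)
    (hd : Disjoint v (lessPossible w φ)) (hφ : φ ∈ v) (h : φ □→ ψ ∈ w) : ψ ∈ v := by
  have := Set.disjoint_right.1 hd (and_neg_mem_lessPossible hw h)
  rw [hv.mem_and, hv.mem_neg] at this
  tauto

/-- If all worlds of the sphere of a cut verify `φ ⇾ ψ`, and the cut leaves out `φ`, then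
`φ □→ ψ` holds. -/
theorem cf_mem (hw : IsWorld Sig Γ w) (hQ : IsCut w Q) (hφ : φ ∉ Q)
    (h : ∀ v, IsWorld Sig Γ v → Disjoint v Q → φ ∈ v → ψ ∈ v) : φ □→ ψ ∈ w := by
  have hmem : φ ⋏ neg ψ ∈ Q := by
    by_contra hn
    obtain ⟨v, hv, hm, hd⟩ := hQ.exists_isWorld hw hn
    rw [hv.mem_and, hv.mem_neg] at hm
    exact hm.2 (h v hv hd hm.1)
  refine hw.cf_mono₁ (hw.cf_congr_left (ψ := φ) (fun v hv => ?_) (hQ.cf_neg_mem hmem hφ))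
    fun v hv => ?_
  all_goals simp only [hv.mem_or, hv.mem_and, hv.mem_neg]; tauto

end IsCut

/-- The cuts of a world depend on its comparative possibility only. -/
theorem IsCut.congr {w v Q : Set Form} (hw : IsWorld Sig Γ w) (hv : IsWorld Sig Γ v)
    (h : ∀ φ ψ, preceq φ ψ ∈ w ↔ preceq φ ψ ∈ v) : IsCut w Q ↔ IsCut v Q := by
  have hbot : ∀ φ, φ □→ bot ∈ w ↔ φ □→ bot ∈ v := fun φ => by
    rw [hw.cf_bot_mem_iff_preceq, hv.cf_bot_mem_iff_preceq, h]
  have hcf : ∀ φ ψ, (φ ⋎ ψ) □→ neg φ ∈ w ↔ (φ ⋎ ψ) □→ neg φ ∈ v := fun φ ψ => by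
    rw [hw.cf_neg_mem_iff_preceq, hv.cf_neg_mem_iff_preceq, hbot, h]
  exact ⟨fun hQ => ⟨fun h => hQ.mem_of_cf_bot ((hbot _).2 h), hQ.top_notMem,
      fun h₁ h₂ => (hcf _ _).1 (hQ.cf_neg_mem h₁ h₂)⟩,
    fun hQ => ⟨fun h => hQ.mem_of_cf_bot ((hbot _).1 h), hQ.top_notMem,
      fun h₁ h₂ => (hcf _ _).2 (hQ.cf_neg_mem h₁ h₂)⟩⟩

/-! ### Optional axioms inside a world -/

namespace IsWorld

variable {w v : Set Form} {φ ψ : Form}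

theorem extra_mem (hw : IsWorld Sig Γ w) {a : AxName} (ha : a ∈ Sig) (h : ExtraAxiom a φ) :
    φ ∈ w :=
  hw.of_proves (.extra ha h)

theorem cf_mp_of_W (hw : IsWorld Sig Γ w) (ha : .W ∈ Sig) (h : φ □→ ψ ∈ w) (hφ : φ ∈ w) :
    ψ ∈ w :=
  hw.mp (hw.mp (hw.extra_mem ha (.W φ ψ)) h) hφ

theorem cf_mp_of_C (hw : IsWorld Sig Γ w) (ha : .C ∈ Sig) (h : φ □→ ψ ∈ w) (hφ : φ ∈ w) :
    ψ ∈ w :=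
  hw.mp (hw.mp (hw.mem_and.1 (hw.extra_mem ha (.C φ ψ))).1 h) hφ

theorem cf_mem_of_C (hw : IsWorld Sig Γ w) (ha : .C ∈ Sig) (hφ : φ ∈ w) (hψ : ψ ∈ w) :
    φ □→ ψ ∈ w :=
  hw.mp (hw.mem_and.1 (hw.extra_mem ha (.C φ ψ))).2 (hw.mem_and.2 ⟨hφ, hψ⟩)

/-- Modus ponens for the counterfactual makes everything true at `w` possible at `w`. -/
theorem disjoint_impossible_of_mp (hw : IsWorld Sig Γ w)
    (h : ∀ φ, φ □→ bot ∈ w → φ ∈ w → bot ∈ w) : Disjoint w (impossible w) :=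
  Set.disjoint_left.2 fun φ hφ h' => hw.bot_notMem (h φ h' hφ)

theorem disjoint_impossible_of_T (hw : IsWorld Sig Γ w) (ha : .T ∈ Sig) :
    Disjoint w (impossible w) := by
  refine Set.disjoint_left.2 fun φ hφ h => hw.mem_neg.1 (hw.mp (hw.extra_mem ha (.T (neg φ)))
    (hw.box_mem.2 ?_)) hφ
  exact hw.cf_congr_left (fun v hv => by rw [hv.mem_neg, hv.mem_neg, not_not]) h

theorem cf_top_bot_notMem_of_N (hw : IsWorld Sig Γ w) (ha : .N ∈ Sig) : top □→ bot ∉ w :=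
  hw.dia_mem.1 (hw.mp (hw.extra_mem ha (.N top))
    (hw.cf_of_forall fun _ hv _ => hv.top_mem))

theorem cf_top_bot_notMem (hv : IsWorld Sig Γ v) (hd : Disjoint v (impossible w)) :
    top □→ bot ∉ w :=
  Set.disjoint_left.1 hd hv.top_mem

theorem impossible_eq_of_U (hw : IsWorld Sig Γ w) (hv : IsWorld Sig Γ v) (ha : .U ∈ Sig)
    (hd : Disjoint v (impossible w)) : impossible v = impossible w := by
  -- what is necessary at `w` is true at `v`
  have hbox : ∀ φ, box φ ∈ w → φ ∈ v := fun φ h => by_contra fun hn =>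
    Set.disjoint_left.1 hd (hv.mem_neg.2 hn) (hw.box_mem.1 h)
  ext φ
  have hU := fun φ => hw.mem_and.1 (hw.extra_mem ha (.U φ))
  constructor
  · intro h
    by_contra hn
    exact hv.dia_mem.1 (hbox _ (hw.mp (hU φ).1 (hw.dia_mem.2 hn))) h
  · intro h
    have h' : box (neg φ) ∈ w :=
      hw.box_mem.2 (hw.cf_congr_left (fun v hv => by rw [hv.mem_neg, hv.mem_neg, not_not]) h)
    exact hv.cf_congr_left (fun v hv => by rw [hv.mem_neg, hv.mem_neg, not_not])
      (hv.box_mem.1 (hbox _ (hw.mp (hU (neg φ)).2 h')))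

theorem preceq_mem_iff_of_A (hw : IsWorld Sig Γ w) (hv : IsWorld Sig Γ v) (ha : .A ∈ Sig)
    (hd : Disjoint v (impossible w)) (φ ψ : Form) : preceq φ ψ ∈ v ↔ preceq φ ψ ∈ w := by
  have hbox : ∀ φ, box φ ∈ w → φ ∈ v := fun φ h => by_contra fun hn =>
    Set.disjoint_left.1 hd (hv.mem_neg.2 hn) (hw.box_mem.1 h)
  refine ⟨fun h => ?_, fun h => hbox _ (hw.mp (hw.mem_and.1 (hw.extra_mem ha (.A φ ψ))).1 h)⟩
  by_contra hn
  exact hv.mem_neg.1 (hbox _ (hw.mp (hw.mem_and.1 (hw.extra_mem ha (.A ψ φ))).2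
    (hw.mem_neg.2 hn))) h

end IsWorld

/-! ### The canonical model -/

/-- The worlds that agree with `w₀` on what U makes constant, the impossible formulas, and on what
A makes constant, comparative possibility, if these axioms are present. -/
structure Agrees (Sig : Set AxName) (w₀ w : Set Form) : Prop where
  impossible_eq : .U ∈ Sig → impossible w = impossible w₀
  preceq_mem_iff : .A ∈ Sig → ∀ φ ψ, preceq φ ψ ∈ w ↔ preceq φ ψ ∈ w₀

theorem Agrees.trans {w₀ w v : Set Form} (h : Agrees Sig w₀ w) (hw : IsWorld Sig Γ w)
    (hv : IsWorld Sig Γ v) (hd : Disjoint v (impossible w)) : Agrees Sig w₀ v where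
  impossible_eq ha := (hw.impossible_eq_of_U hv ha hd).trans (h.impossible_eq ha)
  preceq_mem_iff ha φ ψ := (hw.preceq_mem_iff_of_A hv ha hd φ ψ).trans (h.preceq_mem_iff ha φ ψ)

theorem IsCut.disjoint_impossible {w v Q : Set Form} (hQ : IsCut w Q) (hd : Disjoint v Q) :
    Disjoint v (impossible w) :=
  hd.mono_right fun _ => hQ.mem_of_cf_bot

/-- The canonical model around `w₀`. Its worlds are the complete consistent theories that agree
with `w₀`, and the spheres around a world `w` are the sets of the worlds disjoint from `Q`, for
the cuts `Q` of `w`. -/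
def canonicalModel (Sig : Set AxName) (Γ w₀ : Set Form) : SphereModel.{u} where
  World := ULift.{u} {w : Set Form // IsWorld Sig Γ w ∧ Agrees Sig w₀ w}
  sph w := {X | ∃ Q, IsCut w.down.1 Q ∧ X = {v | Disjoint v.down.1 Q}}
  nested := by
    rintro ⟨w, hw, hA⟩ X ⟨Q, hQ, rfl⟩ Y ⟨R, hR, rfl⟩
    have hne : ∀ Q, IsCut w Q → ∃ v : ULift.{u} {w : Set Form // IsWorld Sig Γ w ∧
        Agrees Sig w₀ w}, Disjoint v.down.1 Q := fun Q hQ => by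
      obtain ⟨v, hv, -, hd⟩ := hQ.exists_isWorld hw hQ.top_notMem
      exact ⟨⟨v, hv, hA.trans hw hv (hQ.disjoint_impossible hd)⟩, hd⟩
    exact (hQ.subset_or_subset hw hR).symm.imp
      (fun h => ⟨hne Q hQ, fun v hv => Disjoint.mono_right h hv⟩)
      (fun h => ⟨hne R hR, fun v hv => Disjoint.mono_right h hv⟩)
  val n := {w | var n ∈ w.down.1}

namespace canonicalModel

variable {w₀ : Set Form} {φ ψ : Form}

theorem isWorld (w : (canonicalModel.{u} Sig Γ w₀).World) : IsWorld Sig Γ w.down.1 := w.down.2.1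

theorem exists_world (w : (canonicalModel.{u} Sig Γ w₀).World) {Q : Set Form}
    (hQ : IsCut w.down.1 Q) (hφ : φ ∉ Q) :
    ∃ v : (canonicalModel.{u} Sig Γ w₀).World, φ ∈ v.down.1 ∧ Disjoint v.down.1 Q := by
  obtain ⟨v, hv, h, hd⟩ := hQ.exists_isWorld (isWorld w) hφ
  exact ⟨⟨v, hv, w.down.2.2.trans (isWorld w) hv (hQ.disjoint_impossible hd)⟩, h, hd⟩

theorem mem_sUnion_sph (w v : (canonicalModel.{u} Sig Γ w₀).World) :
    v ∈ ⋃₀ (canonicalModel.{u} Sig Γ w₀).sph w ↔ Disjoint v.down.1 (impossible w.down.1) := by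
  constructor
  · rintro ⟨_, ⟨Q, hQ, rfl⟩, hd⟩
    exact hQ.disjoint_impossible hd
  · exact fun hd => ⟨_, ⟨_, (isWorld w).isCut_impossible
      ((isWorld v).cf_top_bot_notMem hd), rfl⟩, hd⟩

theorem cf_bot_notMem {w v : (canonicalModel.{u} Sig Γ w₀).World}
    (hv : v ∈ ⋃₀ (canonicalModel.{u} Sig Γ w₀).sph w) (hφ : φ ∈ v.down.1) :
    φ □→ bot ∉ w.down.1 :=
  Set.disjoint_left.1 ((mem_sUnion_sph w v).1 hv) hφ

/-- The truth lemma. -/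
theorem mem_ext (φ : Form) (w : (canonicalModel.{u} Sig Γ w₀).World) :
    w ∈ (canonicalModel.{u} Sig Γ w₀).ext φ ↔ φ ∈ w.down.1 := by
  induction φ generalizing w with
  | var n => exact Iff.rfl
  | bot => exact iff_of_false (SphereModel.notMem_ext_bot _ w) (isWorld w).bot_notMem
  | top => exact iff_of_true (SphereModel.mem_ext_top _ w) (isWorld w).top_mem
  | and φ ψ ih₁ ih₂ => rw [SphereModel.mem_ext_and, ih₁, ih₂, (isWorld w).mem_and]
  | or φ ψ ih₁ ih₂ => rw [SphereModel.mem_ext_or, ih₁, ih₂, (isWorld w).mem_or]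
  | imp φ ψ ih₁ ih₂ => rw [SphereModel.mem_ext_imp, ih₁, ih₂, (isWorld w).mem_imp]
  | cf φ ψ ih₁ ih₂ =>
    rw [SphereModel.mem_ext_cf]
    simp only [ih₁, ih₂]
    constructor
    · rintro (h | ⟨_, ⟨Q, hQ, rfl⟩, ⟨x, hx, hxφ⟩, h⟩)
      · refine (isWorld w).cf_of_cf_bot (by_contra fun hn => ?_)
        have hQ := (isWorld w).isCut_lessPossible hn
        obtain ⟨v, hφ, hd⟩ := exists_world w hQ (IsCut.notMem_lessPossible (isWorld w) hn)
        exact h _ ⟨_, hQ, rfl⟩ v hd hφ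
      · refine hQ.cf_mem (isWorld w) (Set.disjoint_left.1 hx hxφ) fun v hv hd => ?_
        exact h ⟨v, hv, w.down.2.2.trans (isWorld w) hv (hQ.disjoint_impossible hd)⟩ hd
    · intro h
      by_cases hn : φ □→ bot ∈ w.down.1
      · exact Or.inl fun X hX x hx hφ => cf_bot_notMem ⟨X, hX, hx⟩ hφ hn
      · have hQ := (isWorld w).isCut_lessPossible hn
        obtain ⟨v, hφ, hd⟩ := exists_world w hQ (IsCut.notMem_lessPossible (isWorld w) hn)
        exact Or.inr ⟨_, ⟨_, hQ, rfl⟩, ⟨v, hd, hφ⟩, fun x hx hφ =>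
          IsCut.mem_of_disjoint_lessPossible (isWorld w) (isWorld x) hx hφ h⟩

theorem weaklyCentered (h : .W ∈ Sig) : (canonicalModel.{u} Sig Γ w₀).WeaklyCentered := by
  intro w
  have hw := isWorld w
  have hd : Disjoint w.down.1 (impossible w.down.1) :=
    hw.disjoint_impossible_of_mp fun φ => hw.cf_mp_of_W h
  obtain ⟨X, hX, hwX⟩ := (mem_sUnion_sph w w).2 hd
  refine ⟨⟨X, hX, w, hwX⟩, ?_⟩
  rintro _ ⟨Q, hQ, rfl⟩ -
  refine Set.disjoint_left.2 fun φ hφ hφQ => ?_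
  -- a formula of the cut is strictly less possible than `top`
  exact hw.mem_neg.1 (hw.cf_mp_of_W h (hQ.cf_neg_mem hφQ hQ.top_notMem)
    (hw.mem_or.2 (Or.inl hφ))) hφ

theorem centered (h : .C ∈ Sig) : (canonicalModel.{u} Sig Γ w₀).Centered := by
  intro w
  have hw := isWorld w
  -- the cut of the formulas that are false at `w`
  refine ⟨{χ | χ ∉ w.down.1}, ⟨fun {ψ} hψ hmem => hw.bot_notMem (hw.cf_mp_of_C h hψ hmem),
    fun hn => hn hw.top_mem, fun {ψ χ} hψ hχ => ?_⟩, ?_⟩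
  · exact hw.cf_mem_of_C h (hw.mem_or.2 (Or.inr (not_not.1 hχ))) (hw.mem_neg.2 hψ)
  · ext v
    refine ⟨fun hv => hv ▸ Set.disjoint_left.2 fun _ h h' => h' h, fun hd => ?_⟩
    exact ULift.down_injective (Subtype.ext (hw.eq_of_subset (isWorld v)
      fun φ hφ => not_not.1 (Set.disjoint_left.1 hd hφ)))

theorem normal (h : .N ∈ Sig) : (canonicalModel.{u} Sig Γ w₀).Normal := by
  intro w
  have hQ := (isWorld w).isCut_impossible ((isWorld w).cf_top_bot_notMem_of_N h)
  obtain ⟨v, -, hd⟩ := exists_world w hQ hQ.top_notMem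
  exact ⟨v, (mem_sUnion_sph w v).2 hd⟩

theorem totallyReflexive (h : .T ∈ Sig) : (canonicalModel.{u} Sig Γ w₀).TotallyReflexive :=
  fun w => (mem_sUnion_sph w w).2 ((isWorld w).disjoint_impossible_of_T h)

/-- Under S, for `φ` possible at `w`, the formulas `ψ` with `φ □→ ψ` form a complete theory, so
that only one world of the sphere of `lessPossible w φ` verifies `φ`. -/
theorem stalnakerian (h : .S ∈ Sig) : (canonicalModel.{u} Sig Γ w₀).Stalnakerian := by
  rintro w φ ⟨x, hxφ, hx⟩
  have hw := isWorld w
  have hn : φ □→ bot ∉ w.down.1 := cf_bot_notMem hx ((mem_ext φ x).1 hxφ)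
  have hQ := hw.isCut_lessPossible hn
  obtain ⟨y, hyφ, hy⟩ := exists_world w hQ (IsCut.notMem_lessPossible hw hn)
  refine ⟨_, ⟨_, hQ, rfl⟩, y, Set.eq_singleton_iff_unique_mem.2
    ⟨⟨(mem_ext φ y).2 hyφ, hy⟩, fun z hz => ?_⟩⟩
  refine ULift.down_injective (Subtype.ext ((isWorld y).eq_of_subset (isWorld z) fun ψ hψ => ?_))
  rcases hw.mem_or.1 (hw.extra_mem h (.S φ ψ)) with h' | h'
  · exact IsCut.mem_of_disjoint_lessPossible hw (isWorld y) hy hyφ h'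
  · exact absurd hψ ((isWorld z).mem_neg.1 (IsCut.mem_of_disjoint_lessPossible hw (isWorld z) hz.2
      ((mem_ext φ z).1 hz.1) h'))

theorem uniform (h : .U ∈ Sig) : (canonicalModel.{u} Sig Γ w₀).Uniform := by
  intro w v
  ext x
  rw [mem_sUnion_sph, mem_sUnion_sph, w.down.2.2.impossible_eq h, v.down.2.2.impossible_eq h]

theorem absolute (h : .A ∈ Sig) : (canonicalModel.{u} Sig Γ w₀).Absolute := by
  intro w v
  have hwv : ∀ Q, IsCut w.down.1 Q ↔ IsCut v.down.1 Q := fun Q =>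
    IsCut.congr (isWorld w) (isWorld v) fun φ ψ =>
      (w.down.2.2.preceq_mem_iff h φ ψ).trans (v.down.2.2.preceq_mem_iff h φ ψ).symm
  ext X
  exact exists_congr fun Q => and_congr (hwv Q) Iff.rfl

theorem mem_kClass : canonicalModel.{u} Sig Γ w₀ ∈ KClass Sig := by
  intro a ha
  cases a
  exacts [weaklyCentered ha, centered ha, normal ha, totallyReflexive ha, stalnakerian ha,
    uniform ha, absolute ha]

end canonicalModel

/-- Strong completeness: a formula outside a world `w` fails at `w` in the canonical model around
`w`, where the premises are valid because they belong to all worlds. -/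
theorem GVProves.complete {φ : Form} (h : GlobalConsequence (KClass.{u} Sig) Γ φ) :
    GVProves Sig Γ φ := by
  refine gvProves_of_forall_mem fun w hw => ?_
  have hmem := h (canonicalModel Sig Γ w) canonicalModel.mem_kClass
    (fun v γ hγ => (canonicalModel.mem_ext γ v).2 (v.down.2.1.of_proves (.hyp hγ)))
    ⟨w, hw, ⟨fun _ => rfl, fun _ _ _ => Iff.rfl⟩⟩ φ rfl
  exact (canonicalModel.mem_ext φ _).1 hmem

end Lewis

theorem mainTheorem8 (Sig : Set Lewis.AxName) (Γ : Set Lewis.Form) (hΓ : Γ.Finite)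
    (φ : Lewis.Form) :
    Lewis.GVProves Sig Γ φ ↔
      Lewis.GlobalConsequence (Lewis.KClass.{u} Sig) Γ φ := by
  refine ⟨fun d M hM hMΓ w ψ hψ => ?_, Lewis.GVProves.complete⟩
  obtain rfl : ψ = φ := hψ
  exact d.sound hM hMΓ w
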